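/- Let $m,n,k$ be nonnegative integers, $A\in\mathbb{R}^{m\times n}$, $b\in\mathbb{R}^m$ and $C\in\mathbb{R}^{k\times n}$, with $j$-th columns $A_j$ of $A$ and $C_j$ of $C$. For $x,y\in\mathbb{R}^k$ write $x\leqq y$ if $y-x$ has nonnegative components, and $x\le y$ if $x\leqq y$ and $x\ne y$. Consider the multiobjective integer program $$\max\ Cx\quad\text{s.t.}\quad Ax\leqq b,\ x\in\mathbb{Z}^n,\ x\geqq 0 .\tag{MOIP}$$ A feasible $x^*$ is efficient if there is no feasible $x$ with $Cx^*\le Cx$; an efficient $x^*$ is supported if there is $\mu\in\mathbb{R}^k$ with all components positive such that $x^*$ maximizes $\mu^\top Cx$ over the feasible $x$. Let $\mathcal{E}$ consist of the nonempty sets $S\subseteq\mathbb{R}^k$ such that $s\not\le t$ for all $s,t\in S$, together with two further elements $-M_\infty$ and $M_\infty$, which have no members. For nonempty $S,T\subseteq\mathbb{R}^k$ write $S\preceqq T$ if for every $s\in S$ there is $t\in T$ with $s\leqq t$, and $t\not\le s$ for all $s\in S$, $t\in T$. Extend this by $-M_\infty\preceqq S\preceqq M_\infty$, $\pm M_\infty\preceqq\pm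 M_\infty$ (equal signs), $-M_\infty\preceqq M_\infty$, $S\not\preceqq -M_\infty$, $M_\infty\not\preceqq S$ and $M_\infty\not\preceqq -M_\infty$. Sums of sets are Minkowski sums, with $-M_\infty+U=U+(-M_\infty)=-M_\infty$ for every $U$, and $M_\infty+U=U+M_\infty=M_\infty$ for every $U\ne -M_\infty$. A function $F:\mathbb{R}^m\to\mathcal{E}$ is feasible for the set-valued superadditive dual (SDP) if * $\{C_j\}\preceqq F(A_j)$ for $j=1,\dots,n$, * $0\in F(0)$, * $F$ is superadditive: $F(\beta_1)+F(\beta_2)\preceqq F(\beta_1+\beta_2)$ for all $\beta_1,\beta_2\in\mathbb{R}^m$, and * $F$ is nondecreasing: $F(\beta_1)\preceqq F(\beta_2)$ whenever $\beta_1\leqq\beta_2$. **Theorem.** Suppose that (MOIP) has at least one supported efficient solution. Then there is a single function $F^*$ feasible for (SDP) such that $Cx^*\in F^*(b)$ for every supported efficient solution $x^*$ of (MOIP). -/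

import Mathlib

namespace MOIP

/-! On `Fin k → ℝ` Mathlib's `x ≤ y` is the componentwise order `x ≦ y`, and Mathlib's `x < y`
means `x ≤ y` and `x ≠ y`, i.e. it is the Pareto relation written `x ≤ y` in multiobjective
optimization. Strict inequality in all components is written `∀ i, x i < y i`. -/

/-- The extended power set of `ℝᵏ`: the subsets of `ℝᵏ` and two extra elements `-M_∞`, `M_∞`. -/
inductive ExtSet (k : ℕ) : Type
  | negInf : ExtSet k
  | ofSet (S : Set (Fin k → ℝ)) : ExtSet k
  | posInf : ExtSet k

namespace ExtSet

variable {k : ℕ}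

/-- `z ∈ S`; the elements `± M_∞` have no members. -/
def HasMem (z : Fin k → ℝ) : ExtSet k → Prop
  | negInf => False
  | ofSet S => z ∈ S
  | posInf => False

/-- The Pareto set-ordering: for subsets of `ℝᵏ`, every `s ∈ S` lies below some `t ∈ T`, and no
`t ∈ T` is dominated by some `s ∈ S`. It is extended by `-M_∞ ≼ S ≼ M_∞`, and
`S ⋠ -M_∞`, `M_∞ ⋠ S` for sets `S`. -/
def SetLE : ExtSet k → ExtSet k → Prop
  | negInf, _ => True
  | ofSet _, negInf => False
  | ofSet S, ofSet T => (∀ s ∈ S, ∃ t ∈ T, s ≤ t) ∧ (∀ s ∈ S, ∀ t ∈ T, ¬ t < s)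
  | ofSet _, posInf => True
  | posInf, negInf => False
  | posInf, ofSet _ => False
  | posInf, posInf => True

/-- The Minkowski sum. It is extended to `± M_∞` so that `-M_∞` (the value of an infeasible
maximization problem) is absorbing, as the empty set is for the Minkowski sum, and the sum of
`M_∞` and anything except `-M_∞` is `M_∞`. -/
def msum : ExtSet k → ExtSet k → ExtSet k
  | negInf, _ => negInf
  | ofSet _, negInf => negInf
  | ofSet S, ofSet T => ofSet (Set.image2 (fun s t => s + t) S T)
  | ofSet _, posInf => posInf
  | posInf, negInf => negInf
  | posInf, ofSet _ => posInf
  | posInf, posInf => posInf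

/-- Membership in the family `ℰ`: the nonempty subsets of `ℝᵏ` whose elements are pairwise not
dominated by each other, together with `± M_∞`. -/
def InE : ExtSet k → Prop
  | negInf => True
  | ofSet S => S.Nonempty ∧ ∀ s ∈ S, ∀ t ∈ S, ¬ s < t ∧ ¬ t < s
  | posInf => True

end ExtSet

variable {m n k : ℕ}

/-- The objective values (or constraint values) `M x` of an integer vector `x`. -/
def intMulVec (M : Matrix (Fin m) (Fin n) ℝ) (x : Fin n → ℤ) : Fin m → ℝ :=
  M.mulVec (fun j => (x j : ℝ))

/-- The feasible region `{x ∈ ℤⁿ | x ≧ 0, A x ≦ β}`. -/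
def feasibleSet (A : Matrix (Fin m) (Fin n) ℝ) (β : Fin m → ℝ) : Set (Fin n → ℤ) :=
  {x | 0 ≤ x ∧ intMulVec A x ≤ β}

/-- `x` is an efficient solution of `max C x, A x ≦ b, x ∈ ℤⁿ, x ≧ 0`: it is feasible and
`C x` is not dominated by the value of another feasible point. -/
def IsEfficient (A : Matrix (Fin m) (Fin n) ℝ) (b : Fin m → ℝ) (C : Matrix (Fin k) (Fin n) ℝ)
    (x : Fin n → ℤ) : Prop :=
  x ∈ feasibleSet A b ∧ ∀ y ∈ feasibleSet A b, ¬ intMulVec C x < intMulVec C y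

/-- `x` is an optimal solution of the weighted-sum scalarization
`max μᵀ C x, A x ≦ b, x ∈ ℤⁿ, x ≧ 0`. -/
def IsScalarOptimal (A : Matrix (Fin m) (Fin n) ℝ) (b : Fin m → ℝ)
    (C : Matrix (Fin k) (Fin n) ℝ) (μ : Fin k → ℝ) (x : Fin n → ℤ) : Prop :=
  x ∈ feasibleSet A b ∧
    ∀ y ∈ feasibleSet A b, dotProduct μ (intMulVec C y) ≤ dotProduct μ (intMulVec C x)

/-- A supported efficient solution: efficient, and optimal for the scalarization with some
componentwise positive weight vector. -/
def IsSupported (A : Matrix (Fin m) (Fin n) ℝ) (b : Fin m → ℝ) (C : Matrix (Fin k) (Fin n) ℝ)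
    (x : Fin n → ℤ) : Prop :=
  IsEfficient A b C x ∧ ∃ μ : Fin k → ℝ, (∀ i, 0 < μ i) ∧ IsScalarOptimal A b C μ x

/-- `F : ℝᵐ → ℰ` is nondecreasing with respect to the Pareto set-ordering. -/
def Nondecreasing (F : (Fin m → ℝ) → ExtSet k) : Prop :=
  ∀ β₁ β₂ : Fin m → ℝ, β₁ ≤ β₂ → (F β₁).SetLE (F β₂)

/-- `F : ℝᵐ → ℰ` is superadditive with respect to the Pareto set-ordering. -/
def Superadditive (F : (Fin m → ℝ) → ExtSet k) : Prop :=
  ∀ β₁ β₂ : Fin m → ℝ, ((F β₁).msum (F β₂)).SetLE (F (β₁ + β₂))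

/-- Feasibility for the set-valued superadditive dual. Here `fun i => A i j` and `fun i => C i j`
are the `j`-th columns of `A` and `C`. -/
structure SDPFeasible (A : Matrix (Fin m) (Fin n) ℝ) (C : Matrix (Fin k) (Fin n) ℝ)
    (F : (Fin m → ℝ) → ExtSet k) : Prop where
  inE : ∀ β, (F β).InE
  col : ∀ j : Fin n, (ExtSet.ofSet {fun i => C i j}).SetLE (F (fun i => A i j))
  zero_mem : ExtSet.HasMem 0 (F 0)
  superadditive : Superadditive F
  nondecreasing : Nondecreasing F

end MOIP

namespace MOIP

/-! Fix the positive weight `μ` of one supported solution and let `F β` be the maximal elements of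
the closure of the value set, with `M_∞` where `μ` is unbounded. The closure matters: for real data
the value set need not be closed, and closedness with a bound on `μ` puts a maximal point above each
value (`exists_maximal_ge`). Superadditivity and monotonicity then follow from additivity and
inclusion of value sets. One `F` serves all supported solutions because `μ` decides only where the
value is `M_∞`, while maximality is independent of the weight. -/

open scoped Classical in
/-- The element of `ℰ` describing a set `D` of values: `-M_∞` if `D` is empty, the set of maximal
elements of `D` if `μᵀ z` is bounded above on `D`, and `M_∞` otherwise. -/
noncomputable def paretoFront {k : ℕ} (μ : Fin k → ℝ) (D : Set (Fin k → ℝ)) : ExtSet k :=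
  if D = ∅ then ExtSet.negInf
  else if BddAbove (dotProduct μ '' D) then ExtSet.ofSet {z | Maximal (· ∈ D) z}
  else ExtSet.posInf

/-- The closure of the set of objective values attained with right-hand side `β`. -/
def valueClosure {m n k : ℕ} (A : Matrix (Fin m) (Fin n) ℝ) (C : Matrix (Fin k) (Fin n) ℝ)
    (β : Fin m → ℝ) : Set (Fin k → ℝ) :=
  closure (intMulVec C '' feasibleSet A β)

/-! ### Maximal elements of closed sets and the set-ordering. -/

section ParetoFront

variable {k : ℕ} {μ : Fin k → ℝ} {D E G : Set (Fin k → ℝ)}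

lemma continuous_dotProduct_left (μ : Fin k → ℝ) : Continuous (dotProduct μ) := by
  unfold dotProduct
  fun_prop

lemma dotProduct_lt_of_lt (hμ : ∀ i, 0 < μ i) {s t : Fin k → ℝ} (h : s < t) :
    dotProduct μ s < dotProduct μ t := by
  obtain ⟨hle, i, hi⟩ := Pi.lt_def.1 h
  exact Finset.sum_lt_sum (fun j _ => mul_le_mul_of_nonneg_left (hle j) (hμ j).le)
    ⟨i, Finset.mem_univ i, mul_lt_mul_of_pos_left hi (hμ i)⟩

lemma maximal_of_dotProduct_le (hμ : ∀ i, 0 < μ i) {s : Fin k → ℝ} (hs : s ∈ D)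
    (h : ∀ z ∈ D, dotProduct μ z ≤ dotProduct μ s) : Maximal (· ∈ D) s := by
  refine ⟨hs, fun t ht hst => ?_⟩
  by_contra hts
  exact (h t ht).not_gt (dotProduct_lt_of_lt hμ (lt_of_le_not_ge hst hts))

/-- Every point of a closed set on which a positive functional is bounded above lies below a
maximal point. -/
lemma exists_maximal_ge (hμ : ∀ i, 0 < μ i) (hD : IsClosed D)
    (hb : BddAbove (dotProduct μ '' D)) {s : Fin k → ℝ} (hs : s ∈ D) :
    ∃ t, Maximal (· ∈ D) t ∧ s ≤ t := by
  obtain ⟨M, hM⟩ := hb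
  -- All weights are positive, so above `s` each term `μ i * (t i - s i)` is at most the total
  -- weighted gain, hence at most `M - dotProduct μ s`.
  have hsub : D ∩ Set.Ici s ⊆ Set.Icc s (fun i => s i + (M - dotProduct μ s) / μ i) := by
    rintro t ⟨htD, hst⟩
    refine ⟨hst, fun i => ?_⟩
    have h1 : μ i * (t i - s i) ≤ dotProduct μ (t - s) :=
      Finset.single_le_sum (f := fun j => μ j * (t - s) j)
        (fun j _ => mul_nonneg (hμ j).le (sub_nonneg.2 (hst j))) (Finset.mem_univ i)
    have h2 : dotProduct μ t ≤ M := hM ⟨t, htD, rfl⟩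
    rw [dotProduct_sub] at h1
    have h3 : t i - s i ≤ (M - dotProduct μ s) / μ i := by
      rw [le_div_iff₀ (hμ i)]
      linarith
    linarith
  have hK : IsCompact (D ∩ Set.Ici s) :=
    isCompact_Icc.of_isClosed_subset (hD.inter isClosed_Ici) hsub
  obtain ⟨t, ⟨htD, hst⟩, htmax⟩ :=
    hK.exists_isMaxOn ⟨s, hs, le_refl s⟩ (continuous_dotProduct_left μ).continuousOn
  have hmax : Maximal (· ∈ D ∩ Set.Ici s) t :=
    maximal_of_dotProduct_le hμ ⟨htD, hst⟩ fun z hz => htmax hz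
  exact ⟨t, ⟨htD, fun w hw htw => hmax.2 ⟨hw, hst.trans htw⟩ htw⟩, hst⟩

lemma paretoFront_empty : paretoFront μ (∅ : Set (Fin k → ℝ)) = ExtSet.negInf := if_pos rfl

lemma paretoFront_of_bddAbove (hne : D.Nonempty) (hb : BddAbove (dotProduct μ '' D)) :
    paretoFront μ D = ExtSet.ofSet {z | Maximal (· ∈ D) z} := by
  rw [paretoFront, if_neg hne.ne_empty, if_pos hb]

lemma paretoFront_of_not_bddAbove (hb : ¬ BddAbove (dotProduct μ '' D)) :
    paretoFront μ D = ExtSet.posInf := by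
  rw [paretoFront, if_neg, if_neg hb]
  rintro rfl
  simp at hb

lemma inE_paretoFront (hμ : ∀ i, 0 < μ i) (hD : IsClosed D) : (paretoFront μ D).InE := by
  rcases D.eq_empty_or_nonempty with rfl | ⟨s, hs⟩
  · rw [paretoFront_empty]
    trivial
  by_cases hb : BddAbove (dotProduct μ '' D)
  · rw [paretoFront_of_bddAbove ⟨s, hs⟩ hb]
    obtain ⟨t, ht, -⟩ := exists_maximal_ge hμ hD hb hs
    exact ⟨⟨t, ht⟩, fun x hx y hy => ⟨hx.not_gt hy.1, hy.not_gt hx.1⟩⟩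
  · rw [paretoFront_of_not_bddAbove hb]
    trivial

lemma hasMem_paretoFront (hb : BddAbove (dotProduct μ '' D)) {s : Fin k → ℝ}
    (hs : Maximal (· ∈ D) s) : ExtSet.HasMem s (paretoFront μ D) := by
  rw [paretoFront_of_bddAbove ⟨s, hs.1⟩ hb]
  exact hs

/-- Common core of the column, monotonicity and superadditivity conditions; no maximality of `S` is
needed. -/
lemma ofSet_setLE_paretoFront (hμ : ∀ i, 0 < μ i) (hD : IsClosed D) (hne : D.Nonempty)
    {S : Set (Fin k → ℝ)} (hS : S ⊆ D) : (ExtSet.ofSet S).SetLE (paretoFront μ D) := by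
  by_cases hb : BddAbove (dotProduct μ '' D)
  · rw [paretoFront_of_bddAbove hne hb]
    refine ⟨fun s hs => exists_maximal_ge hμ hD hb (hS hs), fun s hs t ht hts => ?_⟩
    exact ht.not_gt (hS hs) hts
  · rw [paretoFront_of_not_bddAbove hb]
    trivial

lemma paretoFront_mono (hμ : ∀ i, 0 < μ i) (hE : IsClosed E) (hDE : D ⊆ E) :
    (paretoFront μ D).SetLE (paretoFront μ E) := by
  rcases D.eq_empty_or_nonempty with rfl | hne
  · rw [paretoFront_empty]
    trivial
  by_cases hb : BddAbove (dotProduct μ '' D)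
  · rw [paretoFront_of_bddAbove hne hb]
    exact ofSet_setLE_paretoFront hμ hE (hne.mono hDE) fun s hs => hDE hs.1
  · rw [paretoFront_of_not_bddAbove hb,
      paretoFront_of_not_bddAbove fun h => hb (h.mono (Set.image_mono hDE))]
    trivial

/-- Translation by `s` changes the functional by a constant, so an unbounded summand forces `M_∞` on
the sum. -/
lemma not_bddAbove_of_add (hD : ¬ BddAbove (dotProduct μ '' D)) {s : Fin k → ℝ}
    (h : ∀ t ∈ D, t + s ∈ G) : ¬ BddAbove (dotProduct μ '' G) := by
  rintro ⟨M, hM⟩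
  refine hD ⟨M - dotProduct μ s, ?_⟩
  rintro _ ⟨t, ht, rfl⟩
  have := hM ⟨t + s, h t ht, rfl⟩
  rw [dotProduct_add] at this
  linarith

lemma paretoFront_add (hμ : ∀ i, 0 < μ i) (hG : IsClosed G)
    (hadd : ∀ s ∈ D, ∀ t ∈ E, s + t ∈ G) :
    ((paretoFront μ D).msum (paretoFront μ E)).SetLE (paretoFront μ G) := by
  rcases D.eq_empty_or_nonempty with rfl | ⟨s, hs⟩
  · rw [paretoFront_empty]
    trivial
  rcases E.eq_empty_or_nonempty with rfl | ⟨t, ht⟩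
  · rw [paretoFront_empty]
    cases paretoFront μ D <;> trivial
  by_cases hD : BddAbove (dotProduct μ '' D)
  · by_cases hE : BddAbove (dotProduct μ '' E)
    · rw [paretoFront_of_bddAbove ⟨s, hs⟩ hD, paretoFront_of_bddAbove ⟨t, ht⟩ hE]
      refine ofSet_setLE_paretoFront hμ hG ⟨s + t, hadd s hs t ht⟩ ?_
      rintro _ ⟨x, hx, y, hy, rfl⟩
      exact hadd x hx.1 y hy.1
    · have hG' : ¬ BddAbove (dotProduct μ '' G) :=
        not_bddAbove_of_add hE fun y hy => add_comm s y ▸ hadd s hs y hy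
      rw [paretoFront_of_not_bddAbove hE, paretoFront_of_not_bddAbove hG']
      rw [paretoFront_of_bddAbove ⟨s, hs⟩ hD]
      trivial
  · rw [paretoFront_of_not_bddAbove hD,
      paretoFront_of_not_bddAbove (not_bddAbove_of_add hD fun x hx => hadd x hx t ht)]
    cases h : (paretoFront μ E) <;> trivial

end ParetoFront

/-! ### Value sets of the integer program. -/

section ValueClosure

variable {m n k : ℕ} {A : Matrix (Fin m) (Fin n) ℝ} {b : Fin m → ℝ}
  {C : Matrix (Fin k) (Fin n) ℝ} {μ : Fin k → ℝ}

lemma intMulVec_zero (M : Matrix (Fin m) (Fin n) ℝ) : intMulVec M 0 = 0 := by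
  ext i
  simp [intMulVec, Matrix.mulVec, dotProduct]

lemma intMulVec_add (M : Matrix (Fin m) (Fin n) ℝ) (x y : Fin n → ℤ) :
    intMulVec M (x + y) = intMulVec M x + intMulVec M y := by
  ext i
  simp [intMulVec, Matrix.mulVec, dotProduct, mul_add, Finset.sum_add_distrib]

lemma intMulVec_single (M : Matrix (Fin m) (Fin n) ℝ) (j : Fin n) :
    intMulVec M (Pi.single j 1) = fun i => M i j := by
  ext i
  simp [intMulVec, Matrix.mulVec, dotProduct, Pi.single_apply]

lemma add_mem_feasibleSet {β₁ β₂ : Fin m → ℝ} {x y : Fin n → ℤ} (hx : x ∈ feasibleSet A β₁)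
    (hy : y ∈ feasibleSet A β₂) : x + y ∈ feasibleSet A (β₁ + β₂) :=
  ⟨add_nonneg hx.1 hy.1, intMulVec_add A x y ▸ add_le_add hx.2 hy.2⟩

lemma zero_mem_feasibleSet : (0 : Fin n → ℤ) ∈ feasibleSet A 0 :=
  ⟨le_rfl, (intMulVec_zero A).le⟩

lemma add_mem_valueClosure {β₁ β₂ : Fin m → ℝ} {s t : Fin k → ℝ}
    (hs : s ∈ valueClosure A C β₁) (ht : t ∈ valueClosure A C β₂) :
    s + t ∈ valueClosure A C (β₁ + β₂) := by
  refine map_mem_closure₂ continuous_add hs ht ?_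
  rintro _ ⟨x, hx, rfl⟩ _ ⟨y, hy, rfl⟩
  exact ⟨x + y, add_mem_feasibleSet hx hy, intMulVec_add C x y⟩

lemma valueClosure_mono {β₁ β₂ : Fin m → ℝ} (h : β₁ ≤ β₂) :
    valueClosure A C β₁ ⊆ valueClosure A C β₂ :=
  closure_mono (Set.image_mono fun _ hx => ⟨hx.1, hx.2.trans h⟩)

lemma intMulVec_mem_valueClosure {β : Fin m → ℝ} {x : Fin n → ℤ} (hx : x ∈ feasibleSet A β) :
    intMulVec C x ∈ valueClosure A C β :=
  subset_closure ⟨x, hx, rfl⟩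

/-- A closed half-space containing the attained values contains their limits. -/
lemma IsScalarOptimal.dotProduct_le {x : Fin n → ℤ} (h : IsScalarOptimal A b C μ x)
    {z : Fin k → ℝ} (hz : z ∈ valueClosure A C b) :
    dotProduct μ z ≤ dotProduct μ (intMulVec C x) := by
  refine closure_minimal (t := {z | dotProduct μ z ≤ dotProduct μ (intMulVec C x)}) ?_
    (isClosed_le (continuous_dotProduct_left μ) continuous_const) hz
  rintro _ ⟨y, hy, rfl⟩
  exact h.2 y hy

/-- If a scalarization attains its maximum, then `0` is optimal for it with right-hand side `0`,
as feasible points for the right-hand side `0` can be added to a maximizer. -/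
lemma IsScalarOptimal.zero {x : Fin n → ℤ} (h : IsScalarOptimal A b C μ x) :
    IsScalarOptimal A 0 C μ 0 := by
  refine ⟨zero_mem_feasibleSet, fun y hy => ?_⟩
  have hmem : y + x ∈ feasibleSet A b := by
    simpa using add_mem_feasibleSet hy h.1
  have hle := h.2 _ hmem
  rw [intMulVec_add, dotProduct_add] at hle
  rw [intMulVec_zero, dotProduct_zero]
  linarith

lemma IsScalarOptimal.maximal (hμ : ∀ i, 0 < μ i) {x : Fin n → ℤ}
    (h : IsScalarOptimal A b C μ x) : Maximal (· ∈ valueClosure A C b) (intMulVec C x) :=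
  maximal_of_dotProduct_le hμ (intMulVec_mem_valueClosure h.1) fun _ => h.dotProduct_le

lemma IsScalarOptimal.bddAbove {x : Fin n → ℤ} (h : IsScalarOptimal A b C μ x) :
    BddAbove (dotProduct μ '' valueClosure A C b) := by
  refine ⟨dotProduct μ (intMulVec C x), ?_⟩
  rintro _ ⟨z, hz, rfl⟩
  exact h.dotProduct_le hz

lemma sdpFeasible_paretoFront (hμ : ∀ i, 0 < μ i) {x : Fin n → ℤ}
    (h : IsScalarOptimal A b C μ x) :
    SDPFeasible A C fun β => paretoFront μ (valueClosure A C β) where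
  inE _ := inE_paretoFront hμ isClosed_closure
  col j := by
    have hj : (fun i => C i j) ∈ valueClosure A C (fun i => A i j) := by
      rw [← intMulVec_single C j]
      refine intMulVec_mem_valueClosure ⟨?_, (intMulVec_single A j).le⟩
      exact Pi.single_nonneg.2 zero_le_one
    exact ofSet_setLE_paretoFront hμ isClosed_closure ⟨_, hj⟩ (Set.singleton_subset_iff.2 hj)
  -- Only here is a scalar optimum needed: it excludes `M_∞` at `0` and keeps `0` undominated.
  zero_mem := hasMem_paretoFront h.zero.bddAbove (intMulVec_zero C ▸ h.zero.maximal hμ)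
  superadditive _ _ :=
    paretoFront_add hμ isClosed_closure fun _ hs _ ht => add_mem_valueClosure hs ht
  nondecreasing _ _ hβ := paretoFront_mono hμ isClosed_closure (valueClosure_mono hβ)

end ValueClosure

end MOIP

theorem mainTheorem2 (m n k : ℕ) (A : Matrix (Fin m) (Fin n) ℝ) (b : Fin m → ℝ)
    (C : Matrix (Fin k) (Fin n) ℝ) (hsupp : ∃ x : Fin n → ℤ, MOIP.IsSupported A b C x) :
    ∃ F : (Fin m → ℝ) → MOIP.ExtSet k, MOIP.SDPFeasible A C F ∧
      ∀ x : Fin n → ℤ, MOIP.IsSupported A b C x →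
        MOIP.ExtSet.HasMem (MOIP.intMulVec C x) (F b) := by
  obtain ⟨x₀, -, μ, hμ, h₀⟩ := hsupp
  refine ⟨_, MOIP.sdpFeasible_paretoFront hμ h₀, ?_⟩
  rintro x ⟨-, ν, hν, hx⟩
  -- Boundedness comes from the fixed `μ`, maximality from the weight `ν` of `x` itself.
  exact MOIP.hasMem_paretoFront h₀.bddAbove (hx.maximal hν)
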